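/- Let $N$ be a non-negative integer, let $I\subseteq\mathbb R$ be an interval without a greatest element (for instance $[t_0,\infty)$ or $\mathbb R$), and for each time $t$ let $\mathcal L_t$ be a $\mathbb C$-linear map on the $N\times N$ complex matrices. Call the differential equation $\frac{d\rho(t)}{dt}=\mathcal L_t\rho(t)$ a *Markovian master equation* on $I$ if there are linear maps $\mathcal E_{(t,s)}$, $s\le t$ in $I$, such that - every $\mathcal E_{(t,s)}$ is completely positive (that is, $\mathcal E_{(t,s)}\otimes\mathrm{id}_k$ preserves positive semidefiniteness for every ancilla dimension $k$) and trace preserving; - $\mathcal E_{(s,s)}=\mathrm{id}$, and $\mathcal E_{(t,r)}=\mathcal E_{(t,s)}\mathcal E_{(s,r)}$ for $r\le s\le t$ in $I$; - for every $s\in I$, $\frac{d}{dt}\mathcal E_{(t,s)}=\mathcal L_t\,\mathcal E_{(t,s)}$ for all $t\ge s$ in $I$ (with a one-sided derivative at $t=s$). Say that the equation *has Lindblad form* on $I$ if there are a finite number $m$ and, for every $t\in I$, matrices $H(t)=H(t)^\dagger$ and $V_k(t)$ and reals $\gamma_k(t)\ge 0$ ($1\le k\le m$) such that, for every matrix $\rho$,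 $$\mathcal L_t\rho=-i[H(t),\rho]+\sum_{k=1}^m\gamma_k(t)\Big[V_k(t)\rho V_k^\dagger(t)-\tfrac12\{V_k^\dagger(t)V_k(t),\rho\}\Big].$$ **Theorem 5.1.** If the equation is a Markovian master equation on $I$, then it has Lindblad form on $I$. Conversely, if it has Lindblad form on $I$ and $t\mapsto\mathcal L_t$ is continuous on $I$, then it is a Markovian master equation on $I$. In particular, for a generator that depends continuously on time, a differential equation is a Markovian master equation if and only if it can be written in Lindblad form. -/

import Mathlib

open scoped ComplexOrder Matrix

/-- Linear maps on the operators of the Hilbert space `ℂⁿ` (`n` a finite index set). -/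
abbrev SuperOp (n : Type*) := Matrix n n ℂ →ₗ[ℂ] Matrix n n ℂ

/-- `Φ ⊗ id`, where `id` is the identity map on the operators of a `k`-dimensional ancilla:
`Φ` is applied to each of the `k × k` blocks `(X (·, a) (·, b))` of `X`. -/
def ampliation {n : Type*} (Φ : SuperOp n) (k : ℕ)
    (X : Matrix (n × Fin k) (n × Fin k) ℂ) : Matrix (n × Fin k) (n × Fin k) ℂ :=
  Matrix.of fun p q => Φ (Matrix.of fun i j => X (i, p.2) (j, q.2)) p.1 q.1

/-- `Φ` is completely positive: `Φ ⊗ id` maps positive semidefinite operators to positive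
semidefinite operators for every finite ancilla dimension. -/
def IsCompletelyPositive {n : Type*} (Φ : SuperOp n) : Prop :=
  ∀ (k : ℕ) (X : Matrix (n × Fin k) (n × Fin k) ℂ),
    X.PosSemidef → (ampliation Φ k X).PosSemidef

/-- Universal dynamical maps: completely positive and trace-preserving linear maps. -/
structure IsUDM {n : Type*} [Fintype n] (Φ : SuperOp n) : Prop where
  completelyPositive : IsCompletelyPositive Φ
  trace_preserving : ∀ X : Matrix n n ℂ, (Φ X).trace = X.trace

/-- A Markovian evolution with times in `I`: a two-parameter family `E t s` (`s ≤ t`, evolution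
from time `s` to time `t`) of universal dynamical maps with `E s s = id` and the composition law
`E t r = E t s ∘ E s r` for `r ≤ s ≤ t`. Values of `E` at other pairs of times are irrelevant. -/
structure IsMarkovianEvolution {n : Type*} [Fintype n] (I : Set ℝ)
    (E : ℝ → ℝ → SuperOp n) : Prop where
  udm : ∀ s ∈ I, ∀ t ∈ I, s ≤ t → IsUDM (E t s)
  refl : ∀ s ∈ I, E s s = LinearMap.id
  comp : ∀ r ∈ I, ∀ s ∈ I, ∀ t ∈ I, r ≤ s → s ≤ t → E t r = E t s ∘ₗ E s r

/-- The family `E` consists of propagators of the differential equation `dρ/dt = L_t ρ` on `I`: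
for every initial time `s` and every initial value `X`, the curve `t ↦ E t s X` solves the
equation for all times `t ≥ s` in `I` (with a one-sided derivative at the initial time). -/
def IsGeneratedBy {n : Type*} (I : Set ℝ) (E : ℝ → ℝ → SuperOp n) (L : ℝ → SuperOp n) : Prop :=
  ∀ s ∈ I, ∀ t ∈ I, s ≤ t → ∀ X : Matrix n n ℂ,
    HasDerivWithinAt (fun u : ℝ => E u s X) (L t (E t s X)) (I ∩ Set.Ici s) t

/-- The equation `dρ/dt = L_t ρ`, `t ∈ I`, is a Markovian master equation: it generates a
Markovian evolution. -/
def IsMarkovianMasterEquation {n : Type*} [Fintype n] (I : Set ℝ) (L : ℝ → SuperOp n) : Prop :=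
  ∃ E : ℝ → ℝ → SuperOp n, IsMarkovianEvolution I E ∧ IsGeneratedBy I E L

/-- The equation `dρ/dt = L_t ρ`, `t ∈ I`, can be written in the time-dependent Lindblad form
`dρ/dt = -i[H(t), ρ] + ∑ₖ γₖ(t) (Vₖ(t) ρ Vₖ(t)† - ½ {Vₖ(t)† Vₖ(t), ρ})`
with `H(t)` self-adjoint and `γₖ(t) ≥ 0`. -/
def HasLindbladForm {n : Type*} [Fintype n] (I : Set ℝ) (L : ℝ → SuperOp n) : Prop :=
  ∃ (m : ℕ) (H : ℝ → Matrix n n ℂ) (V : Fin m → ℝ → Matrix n n ℂ) (γ : Fin m → ℝ → ℝ),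
    ∀ t ∈ I, (H t).IsHermitian ∧ (∀ k, 0 ≤ γ k t) ∧
      ∀ X : Matrix n n ℂ,
        L t X = -Complex.I • (H t * X - X * H t) +
          ∑ k, (γ k t : ℂ) • (V k t * X * (V k t)ᴴ -
            (1 / 2 : ℂ) • ((V k t)ᴴ * V k t * X + X * ((V k t)ᴴ * V k t)))

/-!
A Markovian generator at time `t` is the right derivative of `u ↦ E u t` at the identity. The Choi
matrix of a completely positive map is positive semidefinite, and the Choi matrix of the identity
is `|ω⟩⟨ω|` for the maximally entangled vector `ω`. Hence the difference quotients of the Choi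
matrix, and their limit `C`, are Hermitian and positive semidefinite on the complement of `ω`
(`choiMatrix_generator_isHermitian_and_posSemidef`). Splitting `C` along `ω` turns the generator
into `X ↦ ∑ Vₖ X Vₖ† + K X + X K†` (`exists_eq_sum_conjBy_add`), and preservation of the trace
fixes the Hermitian part of `K`, which is the Lindblad form (`exists_eq_lindbladian`). The
number of operators `Vₖ` is the size of the Choi matrix, so it does not depend on `t`.

Conversely, a continuous generator has propagators, given by the Dyson series
(`exists_hasDerivAt_mul_eq`), with the composition law by uniqueness of solutions
(`exists_evolution`). The trace is preserved because a Lindblad generator annihilates it. For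
complete positivity no regularity of `H`, `Vₖ` and `γₖ` in time is available, which rules out a
direct product formula. Instead, the completely positive maps form a closed set, the generator
points into it at each single time (`exists_isCompletelyPositive_id_add_smul_lindbladian`), and a
Grönwall estimate for the distance of the propagator to this set shows that it is never left
(`mem_of_hasDerivWithinAt_of_tangent`).
-/

/-! ### Linear equations in Banach algebras and invariant sets -/

section BanachODE

open Set Filter Topology MeasureTheory

/-- Global existence for the linear equation `f' = A f` in a Banach algebra, on an open interval
on which `A` is continuous but possibly unbounded. The solution is the Dyson series, whose `k`-th
term is bounded by `‖x‖ (M |t - s|) ^ k / k!` wherever `‖A‖ ≤ M`. -/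
theorem exists_hasDerivAt_mul_eq {𝔸 : Type*} [NormedRing 𝔸] [NormedSpace ℝ 𝔸] [CompleteSpace 𝔸]
    {U : Set ℝ} (hU : IsOpen U) (hU' : U.OrdConnected) {A : ℝ → 𝔸} (hA : ContinuousOn A U)
    {s : ℝ} (hs : s ∈ U) (x : 𝔸) :
    ∃ f : ℝ → 𝔸, f s = x ∧ ∀ t ∈ U, HasDerivAt f (A t * f t) t := by
  -- the terms of the Dyson series
  let D : ℕ → ℝ → 𝔸 := fun k => Nat.rec (fun _ => x) (fun _ g t => ∫ u in s..t, A u * g u) k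
  have D_succ : ∀ k t, D (k + 1) t = ∫ u in s..t, A u * D k u := fun _ _ => rfl
  have hstep : ∀ k, ContinuousOn (D k) U →
      ∀ t ∈ U, HasDerivAt (D (k + 1)) (A t * D k t) t := by
    intro k hk t ht
    have hc : ContinuousOn (fun u => A u * D k u) U := hA.mul hk
    exact intervalIntegral.integral_hasDerivAt_right
      (hc.mono (hU'.uIcc_subset hs ht)).intervalIntegrable
      (hc.stronglyMeasurableAtFilter hU t ht) (hc.continuousAt (hU.mem_nhds ht))
  have hcont : ∀ k, ContinuousOn (D k) U := by
    intro k
    induction k with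
    | zero => exact continuousOn_const
    | succ k ih => exact fun t ht => (hstep k ih t ht).continuousAt.continuousWithinAt
  have hD0 : ∀ t, D 0 t = x := fun _ => rfl
  have hDs : ∀ k, D (k + 1) s = 0 := fun k => by simp [D_succ]
  have hsum_s : Summable fun k => D (k + 1) s := by simp [hDs, summable_zero]
  refine ⟨fun t => x + ∑' k, D (k + 1) t, by simp [hDs], fun t ht => ?_⟩
  -- a compact interval inside `U` whose interior contains both `s` and `t`
  obtain ⟨c, d, hsub, hsI, htI⟩ : ∃ c d, Icc c d ⊆ U ∧ s ∈ Ioo c d ∧ t ∈ Ioo c d := by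
    have hmin : min s t ∈ U := by rcases min_choice s t with h | h <;> rwa [h]
    have hmax : max s t ∈ U := by rcases max_choice s t with h | h <;> rwa [h]
    obtain ⟨c, hc, hc'⟩ : ∃ c ∈ U, c < min s t :=
      ((eventually_mem_set.2 (mem_nhdsWithin_of_mem_nhds (hU.mem_nhds hmin))).and
        (self_mem_nhdsWithin : Iio (min s t) ∈ 𝓝[<] (min s t))).exists
    obtain ⟨d, hd, hd'⟩ : ∃ d ∈ U, max s t < d :=
      ((eventually_mem_set.2 (mem_nhdsWithin_of_mem_nhds (hU.mem_nhds hmax))).and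
        (self_mem_nhdsWithin : Ioi (max s t) ∈ 𝓝[>] (max s t))).exists
    rw [lt_min_iff] at hc'
    rw [max_lt_iff] at hd'
    exact ⟨c, d, hU'.out hc hd, ⟨hc'.1, hd'.1⟩, ⟨hc'.2, hd'.2⟩⟩
  obtain ⟨M, hM⟩ := isCompact_Icc.exists_bound_of_continuousOn (hA.mono hsub)
  have hM0 : 0 ≤ M := (norm_nonneg _).trans (hM s (Ioo_subset_Icc_self hsI))
  have hbound : ∀ k, ∀ u ∈ Ioo c d, ‖D k u‖ ≤ ‖x‖ * (M * |u - s|) ^ k / k.factorial := by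
    intro k
    induction k with
    | zero => intro u _; simp [hD0]
    | succ k ih =>
      intro u hu
      have hsu : uIoc s u ⊆ Ioo c d := uIoc_subset_uIcc.trans (ordConnected_Ioo.uIcc_subset hsI hu)
      calc ‖D (k + 1) u‖ ≤ ∫ v in uIoc s u, ‖A v * D k v‖ := by
            rw [D_succ]; exact intervalIntegral.norm_integral_le_integral_norm_uIoc
        _ ≤ ∫ v in uIoc s u, ‖x‖ * M ^ (k + 1) / k.factorial * |v - s| ^ k := by
            refine setIntegral_mono_on ?_ ?_ measurableSet_uIoc fun v hv => ?_
            · have : IntervalIntegrable (fun v => A v * D k v) volume s u :=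
                ((hA.mul (hcont k)).mono (hU'.uIcc_subset hs
                  (hsub (Ioo_subset_Icc_self hu)))).intervalIntegrable
              exact (intervalIntegrable_iff.1 this).norm
            · exact intervalIntegrable_iff.1 (Continuous.intervalIntegrable (by fun_prop) _ _)
            · calc ‖A v * D k v‖ ≤ ‖A v‖ * ‖D k v‖ := norm_mul_le _ _
                _ ≤ M * (‖x‖ * (M * |v - s|) ^ k / k.factorial) := by
                  gcongr
                  · exact hM v (Ioo_subset_Icc_self (hsu hv))
                  · exact ih v (hsu hv)
                _ = _ := by rw [mul_pow]; ring
        _ = ‖x‖ * (M * |u - s|) ^ (k + 1) / (k + 1).factorial := by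
            rw [integral_const_mul, integral_pow_abs_sub_uIoc, Nat.factorial_succ, mul_pow]
            push_cast
            field_simp
  have hsumm : ∀ r : ℝ, Summable fun k : ℕ => ‖x‖ * (M * r) ^ k / k.factorial := fun r => by
    simpa [mul_div_assoc] using (Real.summable_pow_div_factorial (M * r)).mul_left ‖x‖
  have hder := hasDerivAt_tsum_of_isPreconnected (g := fun k => D (k + 1))
    (g' := fun k u => A u * D k u) ((hsumm (d - c)).mul_left M) isOpen_Ioo isPreconnected_Ioo
    (fun k u hu => hstep k (hcont k) u (hsub (Ioo_subset_Icc_self hu)))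
    (fun k u hu => by
      refine (norm_mul_le _ _).trans ?_
      refine mul_le_mul (hM u (Ioo_subset_Icc_self hu)) ((hbound k u hu).trans ?_)
        (norm_nonneg _) hM0
      have : |u - s| ≤ d - c := by
        rw [abs_le]; constructor <;> linarith [hu.1, hu.2, hsI.1, hsI.2]
      gcongr) hsI hsum_s htI
  have hsumt : Summable fun k => D k t :=
    Summable.of_norm_bounded (hsumm |t - s|) fun k => hbound k t htI
  have : A t * (x + ∑' k, D (k + 1) t) = ∑' k, A t * D k t := by
    rw [hsumt.tsum_mul_left, hsumt.tsum_eq_zero_add, hD0]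
  rw [this]
  exact hder.const_add x

/-- Nagumo-type invariance: if `v` is Lipschitz and points into the closed set `S` at each of its
points, in the sense that it is the initial velocity of a curve in `S`, then a solution of
`f' = v t f` that starts in `S` stays in `S`. The distance `d` from `f t` to `S` satisfies
`d' ≤ K d`, by comparing `f` with a curve in `S` through a nearest point of `S`. Since only the
slope of `d` at each single time matters, nothing uniform in `t` is asked of these curves. -/
theorem mem_of_hasDerivWithinAt_of_tangent {V : Type*} [NormedAddCommGroup V] [NormedSpace ℝ V]
    [ProperSpace V] {S : Set V} (hS : IsClosed S) {v : ℝ → V → V} {K : ℝ} {a b : ℝ}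
    (hv : ∀ t ∈ Ico a b, ∀ x y, ‖v t x - v t y‖ ≤ K * ‖x - y‖) {f : ℝ → V}
    (hf : ContinuousOn f (Icc a b)) (ha : f a ∈ S)
    (hf' : ∀ t ∈ Ico a b, HasDerivWithinAt f (v t (f t)) (Ici t) t)
    (htan : ∀ t ∈ Ico a b, ∀ p ∈ S, ∃ g : ℝ → V, g t = p ∧ (∀ u > t, g u ∈ S) ∧
      HasDerivWithinAt g (v t p) (Ici t) t) :
    ∀ t ∈ Icc a b, f t ∈ S := by
  have hne : S.Nonempty := ⟨_, ha⟩
  have key : ∀ t ∈ Icc a b, Metric.infDist (f t) S ≤ gronwallBound 0 K 0 (t - a) := by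
    refine le_gronwallBound_of_liminf_deriv_right_le (f' := fun t => K * Metric.infDist (f t) S)
      ((Metric.continuous_infDist_pt S).comp_continuousOn hf) ?_
      (Metric.infDist_zero_of_mem ha).le (fun t _ => by simp)
    intro t ht r hr
    obtain ⟨p, hp, hdist⟩ := hS.exists_infDist_eq_dist hne (f t)
    obtain ⟨g, hgt, hgS, hg⟩ := htan t ht p hp
    have hq := (hf' t ht).sub hg
    have hlt : ‖v t (f t) - v t p‖ < r :=
      (hv t ht _ _).trans_lt (by rwa [← dist_eq_norm, ← hdist])
    refine (hq.liminf_right_slope_norm_le hlt).mp ?_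
    filter_upwards [self_mem_nhdsWithin] with z hz h
    refine lt_of_le_of_lt ?_ h
    have hz' : 0 ≤ (z - t)⁻¹ := inv_nonneg.2 (sub_nonneg.2 (le_of_lt hz))
    refine mul_le_mul_of_nonneg_left ?_ hz'
    have h1 := Metric.infDist_le_dist_of_mem (x := f z) (hgS z hz)
    rw [dist_eq_norm] at h1 hdist
    simp only [Pi.sub_apply, hgt]
    linarith
  intro t ht
  have h0 := key t ht
  rw [gronwallBound_ε0_δ0] at h0
  exact (hS.mem_iff_infDist_zero hne).2 (le_antisymm h0 Metric.infDist_nonneg)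

end BanachODE

/-! ### Completely positive maps -/

theorem isClosed_posSemidef (m : Type*) [Fintype m] :
    IsClosed {M : Matrix m m ℂ | M.PosSemidef} := by
  simp only [Matrix.posSemidef_iff_dotProduct_mulVec, Set.ofPred_and, Set.ofPred_forall,
    Matrix.IsHermitian]
  refine (isClosed_eq (by fun_prop) continuous_id).inter (isClosed_iInter fun x => ?_)
  have h : Continuous fun M : Matrix m m ℂ => star x ⬝ᵥ M *ᵥ x := by fun_prop
  exact isClosed_Ici.preimage h

section CompletePositivity

open scoped Kronecker

variable {n : Type*}

theorem isCompletelyPositive_id : IsCompletelyPositive (LinearMap.id : SuperOp n) :=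
  fun _ _ hX => hX

theorem IsCompletelyPositive.comp {Φ Ψ : SuperOp n} (hΦ : IsCompletelyPositive Φ)
    (hΨ : IsCompletelyPositive Ψ) : IsCompletelyPositive (Φ ∘ₗ Ψ) :=
  fun k X hX => hΦ k _ (hΨ k X hX)

theorem IsCompletelyPositive.add {Φ Ψ : SuperOp n} (hΦ : IsCompletelyPositive Φ)
    (hΨ : IsCompletelyPositive Ψ) : IsCompletelyPositive (Φ + Ψ) :=
  fun k X hX => (hΦ k X hX).add (hΨ k X hX)

theorem IsCompletelyPositive.smul {Φ : SuperOp n} (hΦ : IsCompletelyPositive Φ) {c : ℝ}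
    (hc : 0 ≤ c) : IsCompletelyPositive ((c : ℂ) • Φ) :=
  fun k X hX => (hΦ k X hX).smul (a := (c : ℂ)) (by exact_mod_cast hc)

theorem IsCompletelyPositive.sum {ι : Type*} (s : Finset ι) {Φ : ι → SuperOp n}
    (hΦ : ∀ i ∈ s, IsCompletelyPositive (Φ i)) : IsCompletelyPositive (∑ i ∈ s, Φ i) := by
  classical
  induction s using Finset.induction_on with
  | empty =>
    intro k X _
    exact (Matrix.PosSemidef.zero : (0 : Matrix (n × Fin k) (n × Fin k) ℂ).PosSemidef)
  | insert i s hi ih =>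
    rw [Finset.sum_insert hi]
    exact (hΦ i (Finset.mem_insert_self i s)).add
      (ih fun j hj => hΦ j (Finset.mem_insert_of_mem hj))

/-- The map `X ↦ V X V†` with the single Kraus operator `V`. -/
def conjBy [Fintype n] (V : Matrix n n ℂ) : SuperOp n :=
  LinearMap.mulLeft ℂ V ∘ₗ LinearMap.mulRight ℂ Vᴴ

@[simp]
theorem conjBy_apply [Fintype n] (V X : Matrix n n ℂ) : conjBy V X = V * X * Vᴴ := by
  simp [conjBy, mul_assoc]

theorem ampliation_conjBy [Fintype n] (V : Matrix n n ℂ) (k : ℕ)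
    (X : Matrix (n × Fin k) (n × Fin k) ℂ) :
    ampliation (conjBy V) k X =
      (V ⊗ₖ (1 : Matrix (Fin k) (Fin k) ℂ)) * X * (V ⊗ₖ (1 : Matrix (Fin k) (Fin k) ℂ))ᴴ := by
  ext ⟨i, a⟩ ⟨j, b⟩
  simp [ampliation, Matrix.mul_apply, Fintype.sum_prod_type, Matrix.one_apply, apply_ite]

theorem isCompletelyPositive_conjBy [Fintype n] (V : Matrix n n ℂ) :
    IsCompletelyPositive (conjBy V) := fun k X hX => by
  rw [ampliation_conjBy]
  exact hX.mul_mul_conjTranspose_same _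

/-- Complete positivity is closed under pointwise convergence. The maps are parametrized by a
space `V` because `SuperOp n` itself carries no topology. -/
theorem isClosed_setOf_isCompletelyPositive_comp [Fintype n] {V : Type*} [TopologicalSpace V]
    {F : V → SuperOp n} (hF : ∀ X, Continuous fun v => F v X) :
    IsClosed {v | IsCompletelyPositive (F v)} := by
  simp only [IsCompletelyPositive, Set.ofPred_forall]
  refine isClosed_iInter fun k => isClosed_iInter fun X => isClosed_iInter fun _ => ?_
  refine (isClosed_posSemidef (n × Fin k)).preimage (f := fun v => ampliation (F v) k X) ?_
  refine continuous_matrix fun p q => ?_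
  exact (hF _).matrix_elem _ _

end CompletePositivity

/-! ### Lindblad generators -/

section Lindbladian

variable {n ι : Type*} [Fintype n] [Fintype ι]

/-- The generator in Lindblad form with Hamiltonian `H`, Lindblad operators `V k` and rates `γ k`.
-/
noncomputable def lindbladian (H : Matrix n n ℂ) (V : ι → Matrix n n ℂ) (γ : ι → ℝ) : SuperOp n :=
  -Complex.I • (LinearMap.mulLeft ℂ H - LinearMap.mulRight ℂ H) +
    ∑ k, (γ k : ℂ) • (conjBy (V k) - (1 / 2 : ℂ) •
      (LinearMap.mulLeft ℂ ((V k)ᴴ * V k) + LinearMap.mulRight ℂ ((V k)ᴴ * V k)))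

theorem lindbladian_apply (H : Matrix n n ℂ) (V : ι → Matrix n n ℂ) (γ : ι → ℝ)
    (X : Matrix n n ℂ) :
    lindbladian H V γ X = -Complex.I • (H * X - X * H) +
      ∑ k, (γ k : ℂ) • (V k * X * (V k)ᴴ -
        (1 / 2 : ℂ) • ((V k)ᴴ * V k * X + X * ((V k)ᴴ * V k))) := by
  simp [lindbladian, mul_assoc]

theorem hasLindbladForm_iff {I : Set ℝ} {L : ℝ → SuperOp n} :
    HasLindbladForm I L ↔ ∃ (m : ℕ) (H : ℝ → Matrix n n ℂ) (V : Fin m → ℝ → Matrix n n ℂ)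
      (γ : Fin m → ℝ → ℝ), ∀ t ∈ I, (H t).IsHermitian ∧ (∀ k, 0 ≤ γ k t) ∧
        L t = lindbladian (H t) (fun k => V k t) (fun k => γ k t) := by
  simp only [HasLindbladForm, LinearMap.ext_iff, lindbladian_apply]

theorem trace_lindbladian (H : Matrix n n ℂ) (V : ι → Matrix n n ℂ) (γ : ι → ℝ)
    (X : Matrix n n ℂ) : (lindbladian H V γ X).trace = 0 := by
  have h : ∀ k, (V k * X * (V k)ᴴ).trace = ((V k)ᴴ * V k * X).trace := fun k => by
    rw [Matrix.trace_mul_cycle]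
  simp only [lindbladian_apply, Matrix.trace_add, Matrix.trace_sum, Matrix.trace_smul,
    Matrix.trace_sub, h, Matrix.trace_mul_comm X]
  simp only [smul_eq_mul, sub_self, mul_zero, zero_add]
  exact Finset.sum_eq_zero fun k _ => by ring

/-- A Lindblad generator points into the cone of completely positive maps at the identity. With
`K = -i H - ½ ∑ γₖ Vₖ† Vₖ` it reads `X ↦ K X + X K† + ∑ γₖ Vₖ X Vₖ†`, and
`X ↦ (1 + h K) X (1 + h K)† + h ∑ γₖ Vₖ X Vₖ†` is completely positive and differs from the Euler
step `id + h L` by `h² K X K†` only. -/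
theorem exists_isCompletelyPositive_id_add_smul_lindbladian {H : Matrix n n ℂ}
    (hH : H.IsHermitian) (V : ι → Matrix n n ℂ) {γ : ι → ℝ} (hγ : ∀ k, 0 ≤ γ k) :
    ∃ R : SuperOp n, ∀ h : ℝ, 0 ≤ h →
      IsCompletelyPositive
        (LinearMap.id + (h : ℂ) • lindbladian H V γ + ((h ^ 2 : ℝ) : ℂ) • R) := by
  classical
  set K : Matrix n n ℂ := -Complex.I • H - (1 / 2 : ℂ) • ∑ k, (γ k : ℂ) • ((V k)ᴴ * V k) with hK
  have hK' : Kᴴ = Complex.I • H - (1 / 2 : ℂ) • ∑ k, (γ k : ℂ) • ((V k)ᴴ * V k) := by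
    simp [hK, Matrix.conjTranspose_sum, hH.eq]
  refine ⟨conjBy K, fun h hh => ?_⟩
  have key : LinearMap.id + (h : ℂ) • lindbladian H V γ + ((h ^ 2 : ℝ) : ℂ) • conjBy K =
      conjBy (1 + (h : ℂ) • K) + (h : ℂ) • ∑ k, (γ k : ℂ) • conjBy (V k) := by
    ext1 X
    have hL : lindbladian H V γ X = K * X + X * Kᴴ + ∑ k, (γ k : ℂ) • (V k * X * (V k)ᴴ) := by
      rw [lindbladian_apply, hK', hK]
      simp only [smul_sub, smul_add, sub_mul, mul_sub, Finset.sum_sub_distrib,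
        Finset.sum_add_distrib, smul_mul_assoc, mul_smul_comm, Finset.sum_mul, Finset.mul_sum,
        Finset.smul_sum, smul_comm (1 / 2 : ℂ), neg_smul, neg_mul]
      abel
    simp only [LinearMap.add_apply, LinearMap.smul_apply, LinearMap.id_apply, conjBy_apply,
      LinearMap.sum_apply, hL, Matrix.conjTranspose_add, Matrix.conjTranspose_one,
      Matrix.conjTranspose_smul, add_mul, mul_add, one_mul, mul_one, smul_mul_assoc,
      mul_smul_comm, smul_smul, smul_add, Complex.star_def, Complex.conj_ofReal]
    push_cast
    rw [pow_two]
    abel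
  rw [key]
  exact (isCompletelyPositive_conjBy _).add
    ((IsCompletelyPositive.sum _ fun k _ => (isCompletelyPositive_conjBy _).smul (hγ k)).smul hh)

end Lindbladian

/-! ### The Choi matrix -/

section Choi

variable {n : Type*} [DecidableEq n]

/-- The Choi matrix of `Φ`, with entry `(Φ |a⟩⟨b|) i j` at `(i, a), (j, b)`: the output index comes
first. -/
def choiMatrix (Φ : SuperOp n) : Matrix (n × n) (n × n) ℂ :=
  Matrix.of fun p q => Φ (Matrix.single p.2 q.2 1) p.1 q.1

@[simp]
theorem choiMatrix_apply (Φ : SuperOp n) (p q : n × n) :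
    choiMatrix Φ p q = Φ (Matrix.single p.2 q.2 1) p.1 q.1 := rfl

theorem choiMatrix_injective [Finite n] :
    Function.Injective (choiMatrix : SuperOp n → Matrix (n × n) (n × n) ℂ) := by
  cases nonempty_fintype n
  intro Φ Ψ h
  refine Matrix.ext_linearMap ℂ fun a b => LinearMap.ext_ring ?_
  ext i j
  exact congrFun₂ h (i, a) (j, b)

variable (n) in
/-- The maximally entangled vector `∑ i, |i⟩ ⊗ |i⟩`, not normalized. -/
def maxEntangled : n × n → ℂ := fun p => if p.1 = p.2 then 1 else 0

theorem choiMatrix_id : choiMatrix (LinearMap.id : SuperOp n) =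
    Matrix.vecMulVec (maxEntangled n) (star (maxEntangled n)) := by
  ext p q
  simp [Matrix.vecMulVec_apply, Matrix.single_apply, maxEntangled, ite_and, eq_comm]
  split_ifs <;> rfl

/-- The Choi matrix is, up to relabelling the ancilla, the image of the positive semidefinite
matrix `|ω⟩⟨ω|` under `Φ ⊗ id`, where `ω` is maximally entangled. -/
theorem IsCompletelyPositive.posSemidef_choiMatrix [Fintype n] {Φ : SuperOp n}
    (hΦ : IsCompletelyPositive Φ) : (choiMatrix Φ).PosSemidef := by
  let e := Fintype.equivFin n
  let ω : n × Fin (Fintype.card n) → ℂ := fun p => if e p.1 = p.2 then 1 else 0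
  have h := (hΦ _ _ (Matrix.posSemidef_vecMulVec_self_star ω)).submatrix
    (fun p : n × n => (p.1, e p.2))
  convert h using 1
  ext p q
  have : Matrix.single p.2 q.2 (1 : ℂ) = Matrix.of fun i j =>
      Matrix.vecMulVec ω (star ω) (i, e p.2) (j, e q.2) := by
    ext i j
    simp [ω, Matrix.single_apply, Matrix.vecMulVec_apply, ite_and, eq_comm]
    split_ifs <;> rfl
  rw [choiMatrix_apply, this]
  rfl

variable [Fintype n]

theorem choiMatrix_conjBy (V : Matrix n n ℂ) : choiMatrix (conjBy V) =
    Matrix.vecMulVec (fun p : n × n => V p.1 p.2) (star fun p : n × n => V p.1 p.2) := by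
  ext p q
  simp [Matrix.vecMulVec_apply, Matrix.mul_apply, Matrix.single_apply, ite_and]

theorem choiMatrix_mulLeft_add_mulRight (K : Matrix n n ℂ) :
    choiMatrix (LinearMap.mulLeft ℂ K + LinearMap.mulRight ℂ Kᴴ) =
      Matrix.vecMulVec (fun p : n × n => K p.1 p.2) (star (maxEntangled n)) +
        Matrix.vecMulVec (maxEntangled n) (star fun p : n × n => K p.1 p.2) := by
  ext p q
  simp [Matrix.vecMulVec_apply, Matrix.mul_apply, Matrix.single_apply, ite_and, maxEntangled,
    eq_comm]

variable (n) in
/-- The orthogonal projection onto the line of the maximally entangled vector, whose squared norm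
is `card n`. For empty `n` the junk value `0⁻¹ = 0` is harmless, as there is only one matrix. -/
noncomputable def maxEntangledProj : Matrix (n × n) (n × n) ℂ :=
  (Fintype.card n : ℂ)⁻¹ • Matrix.vecMulVec (maxEntangled n) (star (maxEntangled n))

variable (n) in
theorem isHermitian_maxEntangledProj : (maxEntangledProj n).IsHermitian := by
  ext p q
  simp [maxEntangledProj, Matrix.vecMulVec_apply, maxEntangled]
  split_ifs <;> simp

variable (n) in
theorem one_sub_maxEntangledProj_mulVec : (1 - maxEntangledProj n) *ᵥ maxEntangled n = 0 := by
  have h : star (maxEntangled n) ⬝ᵥ maxEntangled n = Fintype.card n := by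
    simp [dotProduct, maxEntangled, Fintype.sum_prod_type]
  rcases isEmpty_or_nonempty n with hn | hn
  · exact Subsingleton.elim _ _
  · rw [Matrix.sub_mulVec, Matrix.one_mulVec, maxEntangledProj, Matrix.smul_mulVec,
      Matrix.vecMulVec_mulVec, h]
    ext p
    simp [mul_comm (maxEntangled n p)]

/-- A map whose Choi matrix `C` is Hermitian and positive semidefinite on the orthogonal complement
of the maximally entangled vector has the form `X ↦ ∑ Vₖ X Vₖ† + K X + X K†`. With `Q` the
projection onto that vector, `C = (1 - Q) C (1 - Q) + (1 - ½ Q) C Q + Q C (1 - ½ Q)`: the first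
term gives the `Vₖ`, and the other two are adjoint to each other, of rank at most one, and give
`K`. -/
theorem exists_eq_sum_conjBy_add {Φ : SuperOp n} (hherm : (choiMatrix Φ).IsHermitian)
    (hpos : ((1 - maxEntangledProj n) * choiMatrix Φ * (1 - maxEntangledProj n)).PosSemidef) :
    ∃ (V : n × n → Matrix n n ℂ) (K : Matrix n n ℂ),
      Φ = (∑ k, conjBy (V k)) + (LinearMap.mulLeft ℂ K + LinearMap.mulRight ℂ Kᴴ) := by
  obtain ⟨B, hB⟩ : ∃ B : Matrix (n × n) (n × n) ℂ,
      (1 - maxEntangledProj n) * choiMatrix Φ * (1 - maxEntangledProj n) = Bᴴ * B := by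
    open scoped MatrixOrder in
    exact CStarAlgebra.nonneg_iff_eq_star_mul_self.mp hpos.nonneg
  set Q := maxEntangledProj n with hQ
  set C := choiMatrix Φ with hC
  set ω := maxEntangled n with hω
  let ψ : n × n → ℂ := (Fintype.card n : ℂ)⁻¹ • (((1 - (1 / 2 : ℂ) • Q) * C) *ᵥ ω)
  have h1 : (1 - (1 / 2 : ℂ) • Q) * C * Q = Matrix.vecMulVec ψ (star ω) := by
    conv_lhs => rw [hQ, maxEntangledProj, mul_smul_comm, Matrix.mul_vecMulVec,
      ← Matrix.smul_vecMulVec]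
    rfl
  have h2 : Q * C * (1 - (1 / 2 : ℂ) • Q) = Matrix.vecMulVec ω (star ψ) := by
    have := congrArg Matrix.conjTranspose h1
    rw [Matrix.conjTranspose_vecMulVec, star_star] at this
    rw [← this]
    have hQH : Qᴴ = Q := isHermitian_maxEntangledProj n
    simp [Matrix.conjTranspose_mul, hQH, hherm.eq, mul_assoc]
  refine ⟨fun k => Matrix.of fun i a => star (B k (i, a)), Matrix.of fun i a => ψ (i, a),
    choiMatrix_injective ?_⟩
  have hlin : ∀ (s : Finset (n × n)) (Ψ : n × n → SuperOp n),
      choiMatrix (∑ k ∈ s, Ψ k) = ∑ k ∈ s, choiMatrix (Ψ k) := fun s Ψ => by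
    ext p q
    simp [Matrix.sum_apply]
  have hadd : ∀ Ψ Ψ' : SuperOp n, choiMatrix (Ψ + Ψ') = choiMatrix Ψ + choiMatrix Ψ' :=
    fun _ _ => rfl
  rw [hadd, choiMatrix_mulLeft_add_mulRight, hlin]
  have hBB : ∑ k, choiMatrix (conjBy (Matrix.of fun i a => star (B k (i, a)))) = Bᴴ * B := by
    ext p q
    simp [choiMatrix_conjBy, Matrix.sum_apply, Matrix.mul_apply, Matrix.vecMulVec_apply]
  rw [hBB, ← hB]
  calc C = (1 - Q) * C * (1 - Q) + ((1 - (1 / 2 : ℂ) • Q) * C * Q +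
        Q * C * (1 - (1 / 2 : ℂ) • Q)) := by
        simp only [sub_mul, mul_sub, one_mul, mul_one, smul_mul_assoc, mul_smul_comm]
        module
    _ = _ := by rw [h1, h2]; rfl

/-- When the map also annihilates traces, the Hermitian part of `K` is `-½ ∑ Vₖ† Vₖ`, and the
Hamiltonian is read off from its skew-Hermitian part. -/
theorem exists_eq_lindbladian {Φ : SuperOp n} (hherm : (choiMatrix Φ).IsHermitian)
    (hpos : ((1 - maxEntangledProj n) * choiMatrix Φ * (1 - maxEntangledProj n)).PosSemidef)
    (htr : ∀ X, (Φ X).trace = 0) :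
    ∃ (H : Matrix n n ℂ) (V : n × n → Matrix n n ℂ), H.IsHermitian ∧
      Φ = lindbladian H V fun _ => 1 := by
  obtain ⟨V, K, rfl⟩ := exists_eq_sum_conjBy_add hherm hpos
  have hK : K + Kᴴ = - ∑ k, (V k)ᴴ * V k := by
    rw [← sub_eq_zero, sub_neg_eq_add, Matrix.ext_iff_trace_mul_right]
    intro X
    have h : ∀ k, (V k * X * (V k)ᴴ).trace = ((V k)ᴴ * V k * X).trace := fun k => by
      rw [Matrix.trace_mul_cycle]
    have := htr X
    simp only [LinearMap.add_apply, LinearMap.sum_apply, conjBy_apply, LinearMap.mulLeft_apply,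
      LinearMap.mulRight_apply, Matrix.trace_add, Matrix.trace_sum, h,
      Matrix.trace_mul_comm X] at this
    simp only [add_mul, Finset.sum_mul, Matrix.trace_add, Matrix.trace_sum, zero_mul,
      Matrix.trace_zero]
    linear_combination this
  refine ⟨(Complex.I / 2) • (K - Kᴴ), V, ?_, ?_⟩
  · simp [Matrix.IsHermitian, Matrix.conjTranspose_smul, Matrix.conjTranspose_sub]
    module
  · ext1 X
    have hc : -Complex.I * (Complex.I / 2) = 1 / 2 := by
      linear_combination (-1 / 2 : ℂ) * Complex.I_mul_I
    have h1 : K = (1 / 2 : ℂ) • (K - Kᴴ) - (1 / 2 : ℂ) • ∑ k, (V k)ᴴ * V k := by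
      rw [← neg_neg (∑ k, (V k)ᴴ * V k), ← hK]
      module
    have h2 : Kᴴ = -((1 / 2 : ℂ) • (K - Kᴴ)) - (1 / 2 : ℂ) • ∑ k, (V k)ᴴ * V k := by
      rw [← neg_neg (∑ k, (V k)ᴴ * V k), ← hK]
      module
    rw [lindbladian_apply]
    simp only [Complex.ofReal_one, one_smul, Finset.sum_sub_distrib, smul_mul_assoc,
      mul_smul_comm, ← smul_sub, smul_smul, hc, ← Finset.smul_sum, Finset.sum_add_distrib,
      ← Finset.sum_mul, ← Finset.mul_sum]
    simp only [LinearMap.add_apply, LinearMap.sum_apply, conjBy_apply, LinearMap.mulLeft_apply,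
      LinearMap.mulRight_apply]
    conv_lhs => rw [h2]
    nth_rewrite 1 [h1]
    simp only [sub_mul, mul_sub, smul_mul_assoc, mul_smul_comm, mul_neg]
    module

end Choi

/-! ### From Markovian evolutions to the Lindblad form -/

section Generator

open Set Filter Topology

variable {n : Type*} [Fintype n] {I : Set ℝ} {L : ℝ → SuperOp n}

open scoped Matrix.Norms.Elementwise in
theorem IsGeneratedBy.tendsto_slope {E : ℝ → ℝ → SuperOp n} (hE : IsMarkovianEvolution I E)
    (hL : IsGeneratedBy I E L) {t : ℝ} (ht : t ∈ I) (X : Matrix n n ℂ) :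
    Tendsto (fun u => (u - t)⁻¹ • (E u t X - X)) (𝓝[I ∩ Ioi t] t) (𝓝 (L t X)) := by
  have h := (hL t ht t ht le_rfl X).mono (inter_subset_inter_right I Ioi_subset_Ici_self)
  rw [hasDerivWithinAt_iff_tendsto_slope' (fun h => lt_irrefl t h.2), hE.refl t ht] at h
  simpa only [slope_fun_def, vsub_eq_sub, LinearMap.id_apply, hE.refl t ht] using! h

theorem neBot_nhdsWithin_inter_Ioi (hI : I.OrdConnected) {t u : ℝ} (ht : t ∈ I) (hu : u ∈ I)
    (htu : t < u) : (𝓝[I ∩ Ioi t] t).NeBot := by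
  have : Ioo t u ⊆ I ∩ Ioi t := fun v hv => ⟨hI.out ht hu (Ioo_subset_Icc_self hv), hv.1⟩
  exact NeBot.mono (left_nhdsWithin_Ioo_neBot htu) (nhdsWithin_mono t this)

theorem trace_generator_eq_zero (hI : I.OrdConnected) {E : ℝ → ℝ → SuperOp n}
    (hE : IsMarkovianEvolution I E) (hL : IsGeneratedBy I E L) {t u : ℝ} (ht : t ∈ I)
    (hu : u ∈ I) (htu : t < u) (X : Matrix n n ℂ) : (L t X).trace = 0 := by
  have := neBot_nhdsWithin_inter_Ioi hI ht hu htu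
  have hc : Continuous (Matrix.trace : Matrix n n ℂ → ℂ) := by fun_prop
  refine tendsto_nhds_unique ((hc.tendsto _).comp (hL.tendsto_slope hE ht X))
    (tendsto_const_nhds.congr' ?_)
  filter_upwards [self_mem_nhdsWithin] with v hv
  simp [(hE.udm t ht v hv.1 (le_of_lt hv.2)).trace_preserving]

variable [DecidableEq n]

theorem tendsto_choiMatrix_slope {E : ℝ → ℝ → SuperOp n} (hE : IsMarkovianEvolution I E)
    (hL : IsGeneratedBy I E L) {t : ℝ} (ht : t ∈ I) :
    Tendsto (fun u => (u - t)⁻¹ • (choiMatrix (E u t) - choiMatrix LinearMap.id))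
      (𝓝[I ∩ Ioi t] t) (𝓝 (choiMatrix (L t))) := by
  refine tendsto_pi_nhds.2 fun p => tendsto_pi_nhds.2 fun q => ?_
  exact tendsto_pi_nhds.1 (tendsto_pi_nhds.1
    (hL.tendsto_slope hE ht (Matrix.single p.2 q.2 1)) p.1) q.1

/-- The generator is conditionally completely positive: the difference quotients of the Choi
matrices are Hermitian, and compressed by `1 - maxEntangledProj n`, which kills the Choi matrix of
the identity, they are positive semidefinite; both properties pass to the limit. -/
theorem choiMatrix_generator_isHermitian_and_posSemidef (hI : I.OrdConnected)
    {E : ℝ → ℝ → SuperOp n} (hE : IsMarkovianEvolution I E) (hL : IsGeneratedBy I E L) {t u : ℝ}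
    (ht : t ∈ I) (hu : u ∈ I) (htu : t < u) :
    (choiMatrix (L t)).IsHermitian ∧
      ((1 - maxEntangledProj n) * choiMatrix (L t) * (1 - maxEntangledProj n)).PosSemidef := by
  have := neBot_nhdsWithin_inter_Ioi hI ht hu htu
  have hT := tendsto_choiMatrix_slope hE hL ht
  have hcp : ∀ v ∈ I ∩ Ioi t, (choiMatrix (E v t)).PosSemidef := fun v hv =>
    (hE.udm t ht v hv.1 (le_of_lt hv.2)).completelyPositive.posSemidef_choiMatrix
  have hP : (1 - maxEntangledProj n).IsHermitian :=
    Matrix.isHermitian_one.sub (isHermitian_maxEntangledProj n)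
  constructor
  · have hcl : IsClosed {M : Matrix (n × n) (n × n) ℂ | Mᴴ = M} :=
      isClosed_eq (by fun_prop) continuous_id
    refine hcl.mem_of_tendsto hT ?_
    filter_upwards [self_mem_nhdsWithin] with v hv
    have h1 := (hcp v hv).isHermitian
    have h2 := (isCompletelyPositive_id (n := n)).posSemidef_choiMatrix.isHermitian
    change ((v - t)⁻¹ • (choiMatrix (E v t) - choiMatrix LinearMap.id))ᴴ = _
    rw [Matrix.conjTranspose_smul, Matrix.conjTranspose_sub, h1.eq, h2.eq,
      star_trivial]
  · have hc : Continuous fun M : Matrix (n × n) (n × n) ℂ =>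
        (1 - maxEntangledProj n) * M * (1 - maxEntangledProj n) := by fun_prop
    refine (isClosed_posSemidef (n × n)).mem_of_tendsto ((hc.tendsto _).comp hT) ?_
    filter_upwards [self_mem_nhdsWithin] with v hv
    have h0 : (1 - maxEntangledProj n) * choiMatrix (LinearMap.id : SuperOp n) = 0 := by
      rw [choiMatrix_id, Matrix.mul_vecMulVec, one_sub_maxEntangledProj_mulVec]
      ext; simp [Matrix.vecMulVec_apply]
    have hpos : 0 ≤ (v - t)⁻¹ := inv_nonneg.2 (sub_nonneg.2 (le_of_lt hv.2))
    have h := (hcp v hv).conjTranspose_mul_mul_same (1 - maxEntangledProj n)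
    rw [hP.eq] at h
    simpa only [mem_ofPred_eq, Function.comp_apply, mul_smul_comm, smul_mul_assoc, mul_sub _ _
      (choiMatrix LinearMap.id), sub_mul _ _ (1 - maxEntangledProj n), h0, zero_mul, sub_zero]
      using h.smul hpos

theorem IsMarkovianMasterEquation.hasLindbladForm (hI : I.OrdConnected)
    (hmax : ∀ t ∈ I, ∃ u ∈ I, t < u) (h : IsMarkovianMasterEquation I L) :
    HasLindbladForm I L := by
  obtain ⟨E, hE, hL⟩ := h
  have key : ∀ t, ∃ (H : Matrix n n ℂ) (V : n × n → Matrix n n ℂ), t ∈ I →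
      H.IsHermitian ∧ L t = lindbladian H V fun _ => 1 := by
    intro t
    by_cases ht : t ∈ I
    · obtain ⟨u, hu, htu⟩ := hmax t ht
      obtain ⟨h1, h2⟩ := choiMatrix_generator_isHermitian_and_posSemidef hI hE hL ht hu htu
      obtain ⟨H, V, h⟩ := exists_eq_lindbladian h1 h2 (trace_generator_eq_zero hI hE hL ht hu htu)
      exact ⟨H, V, fun _ => h⟩
    · exact ⟨0, 0, fun h => absurd h ht⟩
  choose H V hHV using key
  let e := Fintype.equivFin (n × n)
  refine hasLindbladForm_iff.2 ⟨_, H, fun k t => V t (e.symm k), fun _ _ => 1, fun t ht =>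
    ⟨(hHV t ht).1, fun _ => zero_le_one, (hHV t ht).2.trans ?_⟩⟩
  ext1 X
  rw [lindbladian_apply, lindbladian_apply, ← e.symm.sum_comp]

end Generator

/-! ### Propagators of linear equations -/

section Propagator

open Set Filter Topology

variable {V : Type*} [NormedAddCommGroup V] [NormedSpace ℂ V]
  {I : Set ℝ} {A : ℝ → V →L[ℂ] V}

/-- Solutions of `f' = A f` with `f s = 1` exist on all of `I ∩ [s, ∞)`. The coefficient is extended
to times before `s` by its value at `s`; its domain is then open, as `I` has no greatest element, so
the derivative is two-sided even at `s`. -/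
theorem exists_propagator [CompleteSpace V] (hI : I.OrdConnected) (hmax : ∀ t ∈ I, ∃ u ∈ I, t < u)
    (hA : ContinuousOn A I) {s : ℝ} (hs : s ∈ I) :
    ∃ f : ℝ → V →L[ℂ] V, f s = 1 ∧ ∀ t ∈ I, s ≤ t → HasDerivAt f (A t * f t) t := by
  let U : Set ℝ := {t | max t s ∈ I}
  have hU : IsOpen U := by
    refine isOpen_iff_mem_nhds.2 fun t ht => ?_
    obtain ⟨u, hu, hlt⟩ := hmax _ ht
    rw [max_lt_iff] at hlt
    filter_upwards [Iio_mem_nhds hlt.1] with v hv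
    exact hI.out hs hu ⟨le_max_right _ _, max_le (le_of_lt hv) hlt.2.le⟩
  have hU' : U.OrdConnected := ⟨fun x hx y hy z hz =>
    hI.out hx hy ⟨max_le_max_right s hz.1, max_le_max_right s hz.2⟩⟩
  have hA' : ContinuousOn (fun t => A (max t s)) U :=
    hA.comp (by fun_prop) fun _ h => h
  obtain ⟨f, hfs, hf⟩ := exists_hasDerivAt_mul_eq hU hU' hA' (s := s)
    (show max s s ∈ I by rwa [max_self]) 1
  refine ⟨f, hfs, fun t ht hst => ?_⟩
  simpa only [max_eq_left hst] using hf t (show max t s ∈ I by rwa [max_eq_left hst])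

theorem eqOn_of_hasDerivAt_mul {a b : ℝ} (hA : ContinuousOn A (Icc a b))
    {f g : ℝ → V →L[ℂ] V} (hf : ∀ t ∈ Icc a b, HasDerivAt f (A t * f t) t)
    (hg : ∀ t ∈ Icc a b, HasDerivAt g (A t * g t) t) (hfg : f a = g a) : EqOn f g (Icc a b) := by
  obtain ⟨M, hM⟩ := isCompact_Icc.exists_bound_of_continuousOn hA
  refine ODE_solution_unique_of_mem_Icc_right (v := fun t x => A t * x) (s := fun _ => univ)
    (K := M.toNNReal) (fun t ht => ?_)
    (fun t ht => (hf t ht).continuousAt.continuousWithinAt)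
    (fun t ht => (hf t (Ico_subset_Icc_self ht)).hasDerivWithinAt) (fun _ _ => mem_univ _)
    (fun t ht => (hg t ht).continuousAt.continuousWithinAt)
    (fun t ht => (hg t (Ico_subset_Icc_self ht)).hasDerivWithinAt) (fun _ _ => mem_univ _) hfg
  refine LipschitzOnWith.of_dist_le_mul fun x _ y _ => ?_
  rw [dist_eq_norm, dist_eq_norm, ← mul_sub]
  exact (norm_mul_le _ _).trans (mul_le_mul_of_nonneg_right
    ((hM t (Ico_subset_Icc_self ht)).trans (Real.le_coe_toNNReal M)) (norm_nonneg _))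

/-- Solutions of `f' = A f` stay in a closed set `S` if at each of its points the Euler step stays
in `S` up to a correction of second order. -/
theorem mem_of_hasDerivAt_mul_of_tangent [FiniteDimensional ℂ V] {a b : ℝ}
    (hA : ContinuousOn A (Icc a b)) {f : ℝ → V →L[ℂ] V}
    (hf : ∀ t ∈ Icc a b, HasDerivAt f (A t * f t) t) {S : Set (V →L[ℂ] V)} (hS : IsClosed S)
    (ha : f a ∈ S)
    (htan : ∀ t ∈ Icc a b, ∀ P ∈ S, ∃ R : V →L[ℂ] V, ∀ h : ℝ, 0 ≤ h →
      P + h • (A t * P) + h ^ 2 • R ∈ S) :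
    ∀ t ∈ Icc a b, f t ∈ S := by
  have : ProperSpace (V →L[ℂ] V) := FiniteDimensional.proper ℂ _
  obtain ⟨M, hM⟩ := isCompact_Icc.exists_bound_of_continuousOn hA
  refine mem_of_hasDerivWithinAt_of_tangent hS (v := fun t x => A t * x) (K := M)
    (fun t ht x y => ?_) (fun t ht => (hf t ht).continuousAt.continuousWithinAt) ha
    (fun t ht => (hf t (Ico_subset_Icc_self ht)).hasDerivWithinAt) (fun t ht P hP => ?_)
  · rw [← mul_sub]
    exact (norm_mul_le _ _).trans (mul_le_mul_of_nonneg_right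
      (hM t (Ico_subset_Icc_self ht)) (norm_nonneg _))
  · obtain ⟨R, hR⟩ := htan t (Ico_subset_Icc_self ht) P hP
    refine ⟨fun u => P + (u - t) • (A t * P) + (u - t) ^ 2 • R, by simp,
      fun u hu => hR _ (sub_nonneg.2 (le_of_lt hu)), ?_⟩
    have h1 : HasDerivAt (fun u : ℝ => u - t) 1 t := (hasDerivAt_id t).sub_const t
    have := ((h1.smul_const (A t * P)).const_add P).add ((h1.pow 2).smul_const R)
    simpa using! this.hasDerivWithinAt


/-- The equation `x' = L t x` with continuous coefficients on a finite-dimensional space has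
propagators with the composition law, and they lie in every closed set of linear maps that contains
the identity and the Euler steps from its members, up to second order. The propagators are stated
as plain linear maps so that the result applies to matrices, where no norm is preferred; continuous
linear maps appear only to say that `S` is closed. -/
theorem exists_evolution [FiniteDimensional ℂ V] (hI : I.OrdConnected)
    (hmax : ∀ t ∈ I, ∃ u ∈ I, t < u) {L : ℝ → V →ₗ[ℂ] V}
    (hL : ∀ x, ContinuousOn (fun t => L t x) I) :
    ∃ E : ℝ → ℝ → V →ₗ[ℂ] V, (∀ s ∈ I, E s s = LinearMap.id) ∧
      (∀ r ∈ I, ∀ s ∈ I, ∀ t ∈ I, r ≤ s → s ≤ t → E t r = E t s ∘ₗ E s r) ∧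
      (∀ s ∈ I, ∀ t ∈ I, s ≤ t → ∀ x, HasDerivAt (fun u => E u s x) (L t (E t s x)) t) ∧
      ∀ S : Set (V →ₗ[ℂ] V), IsClosed {f : V →L[ℂ] V | (f : V →ₗ[ℂ] V) ∈ S} →
        LinearMap.id ∈ S →
        (∀ t ∈ I, ∀ P ∈ S, ∃ R : V →ₗ[ℂ] V, ∀ h : ℝ, 0 ≤ h →
          P + (h : ℂ) • (L t ∘ₗ P) + ((h ^ 2 : ℝ) : ℂ) • R ∈ S) →
        ∀ s ∈ I, ∀ t ∈ I, s ≤ t → E t s ∈ S := by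
  have : CompleteSpace V := FiniteDimensional.complete ℂ V
  let A : ℝ → V →L[ℂ] V := fun t => LinearMap.toContinuousLinearMap (L t)
  have hA : ContinuousOn A I := continuousOn_clm_apply.2 hL
  have key : ∀ s, ∃ f : ℝ → V →L[ℂ] V, s ∈ I →
      f s = 1 ∧ ∀ t ∈ I, s ≤ t → HasDerivAt f (A t * f t) t := by
    intro s
    by_cases hs : s ∈ I
    · obtain ⟨f, hf⟩ := exists_propagator hI hmax hA hs
      exact ⟨f, fun _ => hf⟩
    · exact ⟨0, fun h => absurd h hs⟩
  choose F hF using key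
  have hF1 : ∀ s ∈ I, F s s = 1 := fun s hs => (hF s hs).1
  have hF' : ∀ s ∈ I, ∀ t ∈ I, s ≤ t → HasDerivAt (F s) (A t * F s t) t :=
    fun s hs => (hF s hs).2
  refine ⟨fun t s => F s t, fun s hs => ?_, fun r hr s hs t ht hrs hst => ?_,
    fun s hs t ht hst x => ?_, fun S hS hid htan s hs t ht hst => ?_⟩
  · exact congrArg ContinuousLinearMap.toLinearMap (hF1 s hs)
  -- both sides solve the equation on `[s, t]` with the same value at time `s`
  · have hsub : Icc s t ⊆ I := hI.out hs ht
    have h := eqOn_of_hasDerivAt_mul (hA.mono hsub) (f := F r) (g := fun u => F s u * F r s)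
      (fun u hu => hF' r hr u (hsub hu) (hrs.trans hu.1))
      (fun u hu => by
        rw [← mul_assoc]
        exact (hF' s hs u (hsub hu) hu.1).mul_const (F r s))
      (by rw [hF1 s hs, one_mul]) (right_mem_Icc.2 hst)
    exact congrArg ContinuousLinearMap.toLinearMap h
  · exact (((ContinuousLinearMap.apply ℂ V x).restrictScalars ℝ).hasFDerivAt).comp_hasDerivAt t
      (hF' s hs t ht hst)
  · have hsub : Icc s t ⊆ I := hI.out hs ht
    refine mem_of_hasDerivAt_mul_of_tangent (hA.mono hsub)
      (fun u hu => hF' s hs u (hsub hu) hu.1) hS ?_ ?_ t (right_mem_Icc.2 hst)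
    · rw [hF1 s hs]; exact hid
    · intro u hu P hP
      obtain ⟨R, hR⟩ := htan u (hsub hu) P hP
      refine ⟨LinearMap.toContinuousLinearMap R, fun h hh => ?_⟩
      exact hR h hh

end Propagator

/-! ### From the Lindblad form to Markovian evolutions -/

section Converse

open Set

variable {n : Type*} [Fintype n] {I : Set ℝ} {L : ℝ → SuperOp n}

open scoped Matrix.Norms.Elementwise in
theorem HasLindbladForm.isMarkovianMasterEquation (hI : I.OrdConnected)
    (hmax : ∀ t ∈ I, ∃ u ∈ I, t < u)
    (hL : ∀ X : Matrix n n ℂ, ContinuousOn (fun t => L t X) I) (h : HasLindbladForm I L) :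
    IsMarkovianMasterEquation I L := by
  obtain ⟨m, H, V, γ, hLin⟩ := hasLindbladForm_iff.1 h
  obtain ⟨E, hrefl, hcomp, hder, hinv⟩ := exists_evolution hI hmax hL
  have htr : ∀ t ∈ I, ∀ X, (L t X).trace = 0 := fun t ht X => by
    rw [(hLin t ht).2.2, trace_lindbladian]
  refine ⟨E, ⟨fun s hs t ht hst => ⟨?_, fun X => ?_⟩, hrefl, hcomp⟩,
    fun s hs t ht hst X => (hder s hs t ht hst X).hasDerivWithinAt⟩
  · refine hinv {Φ | IsCompletelyPositive Φ} ?_ isCompletelyPositive_id ?_ s hs t ht hst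
    · refine isClosed_setOf_isCompletelyPositive_comp fun X => ?_
      exact (ContinuousLinearMap.apply ℂ (Matrix n n ℂ) X).continuous
    · intro u hu P hP
      obtain ⟨hH, hγ, hLu⟩ := hLin u hu
      obtain ⟨R, hR⟩ := exists_isCompletelyPositive_id_add_smul_lindbladian hH
        (fun k => V k u) hγ
      refine ⟨R ∘ₗ P, fun h hh => ?_⟩
      have := (hR h hh).comp hP
      rw [← hLu] at this
      exact this
  -- the trace is constant along solutions, because its derivative is the trace of `L u (E u s X)`
  · have hsub : Icc s t ⊆ I := hI.out hs ht
    let τ : Matrix n n ℂ →L[ℝ] ℂ :=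
      LinearMap.toContinuousLinearMap (Matrix.traceLinearMap n ℝ ℂ)
    have h : ∀ u ∈ Icc s t, HasDerivAt (fun u => (E u s X).trace) 0 u := fun u hu => by
      have := τ.hasFDerivAt.comp_hasDerivAt u (hder s hs u (hsub hu) hu.1 X)
      have h0 : τ (L u (E u s X)) = 0 := htr u (hsub hu) _
      exact this.congr_deriv h0
    have := constant_of_has_deriv_right_zero
      (fun u hu => (h u hu).continuousAt.continuousWithinAt)
      (fun u hu => (h u (Ico_subset_Icc_self hu)).hasDerivWithinAt) t (right_mem_Icc.2 hst)
    rw [this, hrefl s hs]; rfl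

end Converse

/-- `I` is an interval of times without a last time (for instance `[t₀, ∞)` or `ℝ`). Every
Markovian master equation on `I` has the Lindblad form; conversely, if the generator depends
continuously on time, the Lindblad form implies that the equation is a Markovian master
equation. -/
theorem theorem5p1 {n : Type*} [Fintype n]
    (I : Set ℝ) (hI : I.OrdConnected) (hmax : ∀ t ∈ I, ∃ u ∈ I, t < u)
    (L : ℝ → SuperOp n) :
    (IsMarkovianMasterEquation I L → HasLindbladForm I L) ∧
      ((∀ X : Matrix n n ℂ, ContinuousOn (fun t => L t X) I) →
        HasLindbladForm I L → IsMarkovianMasterEquation I L) := by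
  classical
  exact ⟨fun h => h.hasLindbladForm hI hmax,
    fun hL h => h.isMarkovianMasterEquation hI hmax hL⟩
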